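/- Let $G$ be a simple graph on $[L]=\{1,\dots,L\}$ with edge set $E(G)$. Let $(\mathcal A,\tau)$ be a $C^*$-probability space, i.e. a unital $C^*$-algebra $\mathcal A$ with a state $\tau$, and assume that $\tau$ is a faithful trace. Let $s_1,\dots,s_L\in\mathcal A$ be $G$-independent standard semicircular elements. This means the following. * Each $s_i$ is self-adjoint with the semicircle law of mean $0$ and variance $1$ as its distribution: $\tau(s_i^n)=\frac1{2\pi}\int_{-2}^{2}t^n\sqrt{4-t^2}\,dt$ for all $n\ge 0$. * The unital subalgebras $\mathcal A_i$ generated by $s_i$ are $G$-independent, that is: (a) for every edge $(i,j)\in E(G)$ the algebras $\mathcal A_i$ and $\mathcal A_j$ are classically independent (they commute, and $\tau(ab)=0$ for all $a\in\mathcal A_i$, $b\in\mathcal A_j$ with $\tau(a)=\tau(b)=0$); and (b) for every $k\ge1$ and every $i\in[L]^k$ such that whenever $j_1<j_2$ and $i_{j_1}=i_{j_2}$ there is $j_3$ with $j_1<j_3<j_2$ and $(i_{j_1},i_{j_3})\notin E(G)$, one has $\tau(a_1\cdots a_k)=0$ for all $a_j\in\mathcal A_{i_j}$ with $\tau(a_j)=0$.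 Let $\mathcal T(G)=\langle v\in[L] : uv=vu \text{ for all } (u,v)\in E(G)\rangle$ be the trace monoid of $G$, and let its Cayley graph be the graph with vertex set $\mathcal T(G)$ in which $w_1,w_2$ are adjacent if and only if $w_1=vw_2$ or $w_2=vw_1$ for some letter $v\in[L]$. Then the adjacency matrix of this Cayley graph is the matrix, in the standard basis, of a bounded operator $A$ on $\ell^2(\mathcal T(G))$, and $$\Big\|\sum_{i=1}^{L}s_i\Big\|=\|A\| ,$$ and this number is also the spectral radius of $A$. -/

import Mathlib

open scoped ComplexOrder

/-! ### Noncommutative probability -/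

/-- `τ` is a faithful tracial state on the unital C⋆-algebra `𝓐`; that is, `(𝓐, τ)` is a
C⋆-probability space whose state `τ` is a faithful trace. -/
structure IsFaithfulTracialState {𝓐 : Type*} [CStarAlgebra 𝓐] (τ : 𝓐 →ₗ[ℂ] ℂ) : Prop where
  map_one : τ 1 = 1
  nonneg : ∀ a : 𝓐, 0 ≤ τ (star a * a)
  faithful : ∀ a : 𝓐, τ (star a * a) = 0 → a = 0
  trace : ∀ a b : 𝓐, τ (a * b) = τ (b * a)

/-- `s` is a standard semicircular element: it is self-adjoint and its distribution is the
semicircle law of mean `0` and variance `1`, with density `√(4 - t²) / (2π)` on `[-2, 2]`. As this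
law has compact support, this means that the moments agree. -/
structure IsSemicircular {𝓐 : Type*} [CStarAlgebra 𝓐] (τ : 𝓐 →ₗ[ℂ] ℂ) (s : 𝓐) : Prop where
  isSelfAdjoint : IsSelfAdjoint s
  moment : ∀ n : ℕ, τ (s ^ n) =
    (((1 / (2 * Real.pi)) * ∫ t in (-2 : ℝ)..2, t ^ n * Real.sqrt (4 - t ^ 2) : ℝ) : ℂ)

/-- Classical independence of a family of unital subalgebras: elements of different subalgebras
commute, and products of centered elements of distinct subalgebras are centered. -/
structure ClassicallyIndependent {𝓐 : Type*} [CStarAlgebra 𝓐] (τ : 𝓐 →ₗ[ℂ] ℂ) {ι : Type*}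
    (𝓑 : ι → Subalgebra ℂ 𝓐) : Prop where
  commute : ∀ i j : ι, i ≠ j → ∀ a ∈ 𝓑 i, ∀ b ∈ 𝓑 j, a * b = b * a
  centered : ∀ m : ℕ, 1 ≤ m → ∀ i : Fin m → ι, Function.Injective i →
    ∀ a : Fin m → 𝓐, (∀ k, a k ∈ 𝓑 (i k)) → (∀ k, τ (a k) = 0) → τ (List.ofFn a).prod = 0

/-- `G`-independence of a family of unital subalgebras indexed by the vertices of the graph `G`. -/
structure GIndependent {𝓐 : Type*} [CStarAlgebra 𝓐] (τ : 𝓐 →ₗ[ℂ] ℂ) {V : Type*}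
    (G : SimpleGraph V) (𝓑 : V → Subalgebra ℂ 𝓐) : Prop where
  independent_of_adj : ∀ i j : V, G.Adj i j → ClassicallyIndependent τ ![𝓑 i, 𝓑 j]
  centered : ∀ k : ℕ, 1 ≤ k → ∀ i : Fin k → V,
    (∀ j₁ j₂ : Fin k, j₁ < j₂ → i j₁ = i j₂ →
      ∃ j₃ : Fin k, j₁ < j₃ ∧ j₃ < j₂ ∧ ¬ G.Adj (i j₁) (i j₃)) →
    ∀ a : Fin k → 𝓐, (∀ j, a j ∈ 𝓑 (i j)) → (∀ j, τ (a j) = 0) → τ (List.ofFn a).prod = 0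

/-- `(s i)` is a family of `G`-independent (standard) semicircular elements: each `s i` is
semicircular, and the unital subalgebras that they generate are `G`-independent. (The `s i` are
self-adjoint, so these are also the unital ⋆-subalgebras that they generate.) -/
structure IsGIndependentSemicircularFamily {𝓐 : Type*} [CStarAlgebra 𝓐] (τ : 𝓐 →ₗ[ℂ] ℂ)
    {V : Type*} (G : SimpleGraph V) (s : V → 𝓐) : Prop where
  semicircular : ∀ i, IsSemicircular τ (s i)
  gIndependent : GIndependent τ G fun i => Algebra.adjoin ℂ {s i}

/-! ### The trace monoid and its Cayley graph -/

/-- The defining relations `uv = vu`, for adjacent `u` and `v`, of the trace monoid. -/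
inductive TraceRel {V : Type*} (G : SimpleGraph V) : FreeMonoid V → FreeMonoid V → Prop
  | comm (u v : V) (h : G.Adj u v) :
      TraceRel G (FreeMonoid.of u * FreeMonoid.of v) (FreeMonoid.of v * FreeMonoid.of u)

/-- The trace monoid `⟨v ∈ V : uv = vu for all edges (u, v) of G⟩`. -/
abbrev TraceMonoid {V : Type*} (G : SimpleGraph V) : Type _ :=
  PresentedMonoid (TraceRel G)

/-- The letter `v`, as an element of the trace monoid. -/
def TraceMonoid.letter {V : Type*} (G : SimpleGraph V) (v : V) : TraceMonoid G :=
  PresentedMonoid.of (TraceRel G) v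

/-- The length of an element of the trace monoid, as a homomorphism to `(ℕ, +)`. -/
def TraceMonoid.length {V : Type*} (G : SimpleGraph V) : TraceMonoid G →* Multiplicative ℕ :=
  PresentedMonoid.lift (fun _ => Multiplicative.ofAdd 1) (by
    rintro _ _ ⟨u, v, _⟩
    simp)

theorem TraceMonoid.letter_mul_ne {V : Type*} (G : SimpleGraph V) (v : V) (w : TraceMonoid G) :
    TraceMonoid.letter G v * w ≠ w := by
  intro h
  have h1 : TraceMonoid.length G (TraceMonoid.letter G v) = Multiplicative.ofAdd 1 :=
    PresentedMonoid.lift_of _ _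
  have h2 := congrArg (fun x => Multiplicative.toAdd (TraceMonoid.length G x)) h
  simp [h1] at h2

/-- The Cayley graph of the trace monoid: `w₁` and `w₂` are adjacent if one of them is obtained
from the other by left multiplication by a letter. -/
def TraceMonoid.cayleyGraph {V : Type*} (G : SimpleGraph V) : SimpleGraph (TraceMonoid G) where
  Adj w₁ w₂ := ∃ v : V, w₁ = TraceMonoid.letter G v * w₂ ∨ w₂ = TraceMonoid.letter G v * w₁
  symm := ⟨fun _ _ ⟨v, h⟩ => ⟨v, h.symm⟩⟩
  loopless := ⟨fun w ⟨v, h⟩ => by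
    rcases h with h | h <;> exact TraceMonoid.letter_mul_ne G v w h.symm⟩

open Classical in
/-- The bounded operator `A` on the complex Hilbert space `ℓ²(W)` is the adjacency operator of the
graph `H` on `W`: its matrix in the standard orthonormal basis of `ℓ²(W)` is the adjacency matrix
of `H`. There is at most one such `A`. -/
def IsAdjacencyOperator {W : Type*} (H : SimpleGraph W)
    (A : lp (fun _ : W => ℂ) 2 →L[ℂ] lp (fun _ : W => ℂ) 2) : Prop :=
  ∀ w w' : W, A (lp.single 2 w' (1 : ℂ)) w = H.adjMatrix ℂ w w'

/-! ### Left division by letters in the trace monoid. -/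

namespace TraceMonoid

variable {V : Type*} {G : SimpleGraph V}

/-! Each word `w` gets an element `chebyshev s w` such that left multiplication by `s v` sends it to
the element of `v * w` plus, if `v` divides `w` on the left, that of the quotient (`mul_chebyshev`).
Summed over `v`, this is the adjacency rule of the Cayley graph.

By `exists_reduced_factorization`, `chebyshev s w` is a `G`-reduced product of Chebyshev polynomials
in single `s v`. These are centered for the semicircle law, so `G`-independence gives `τ (chebyshev
s w) = 0` for `w ≠ 1`; self-adjointness then upgrades this to orthonormality in the GNS space
(`map_star_chebyshev_mul_chebyshev`).

Hence `ℓ²` of the monoid embeds isometrically in the GNS space as a subspace invariant under `x = ∑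
s i`, on which `x` acts as `A`. Thus `A` is bounded, self-adjoint, and `‖A‖ ≤ ‖x‖`. Conversely the
moments of `x` are vacuum moments of `A`, so are at most `‖A‖ ^ n`, and faithfulness of `τ` turns
this into `‖x‖ ≤ ‖A‖` (`norm_le_of_map_pow_le`). Self-adjointness of `A` gives the spectral radius.
-/

theorem letter_mul_comm {u v : V} (h : G.Adj u v) :
    letter G u * letter G v = letter G v * letter G u :=
  PresentedMonoid.mk_eq_mk_of_rel (TraceRel.comm u v h)

/-- Induction on trace monoid elements by multiplying with letters on the left. -/
theorem induction_letter {p : TraceMonoid G → Prop} (one : p 1)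
    (mul : ∀ v w, p w → p (letter G v * w)) (w : TraceMonoid G) : p w := by
  induction w using PresentedMonoid.inductionOn with
  | h a =>
    induction a using FreeMonoid.recOn with
    | one => exact one
    | of_mul x xs ih => rw [map_mul]; exact mul x _ ih

/-- The length of a trace monoid element, as a natural number. -/
def len (w : TraceMonoid G) : ℕ := Multiplicative.toAdd (length G w)

@[simp] theorem len_one : len (1 : TraceMonoid G) = 0 := by simp [len]

@[simp] theorem len_letter_mul (v : V) (w : TraceMonoid G) :
    len (letter G v * w) = len w + 1 := by
  have h1 : length G (letter G v) = Multiplicative.ofAdd 1 := PresentedMonoid.lift_of _ _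
  simp [len, h1, add_comm]

theorem letter_mul_ne_one (v : V) (w : TraceMonoid G) : letter G v * w ≠ 1 := by
  intro h
  simpa using congrArg len h

/-- Counting letters is a homomorphism to a commutative, cancellative monoid, where the common
factor drops out. -/
theorem letter_mul_right_cancel {u v : V} {w : TraceMonoid G}
    (h : letter G u * w = letter G v * w) : u = v := by
  let f : TraceMonoid G →* Multiplicative (V →₀ ℕ) :=
    PresentedMonoid.lift (fun v => Multiplicative.ofAdd (Finsupp.single v 1)) (by
      rintro _ _ ⟨u, v, _⟩
      simp [mul_comm])
  have hf : ∀ v, f (letter G v) = Multiplicative.ofAdd (Finsupp.single v 1) :=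
    fun v => PresentedMonoid.lift_of _ _
  have h' := congrArg f h
  rw [map_mul, map_mul, mul_left_inj, hf, hf] at h'
  exact Finsupp.single_left_injective one_ne_zero (Multiplicative.ofAdd.injective h')

open Classical in
/-- One step of the computation of `leftDiv`: the pair of `w` and of its quotient by the letter `v`
is sent to the same pair for `letter G u * w`. -/
noncomputable def leftDivStep (v u : V) (p : TraceMonoid G × Option (TraceMonoid G)) :
    TraceMonoid G × Option (TraceMonoid G) :=
  (letter G u * p.1,
    if u = v then some p.1 else if G.Adj u v then p.2.map (letter G u * ·) else none)

/-- This compatibility with the defining relations lets the letter-by-letter recursion descend from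
free words to the trace monoid. -/
theorem leftDivStep_comm (v : V) {a b : V} (h : G.Adj a b) (p) :
    leftDivStep (G := G) v a (leftDivStep v b p) = leftDivStep v b (leftDivStep v a p) := by
  have hab := h.ne
  have hc : ∀ w, letter G a * (letter G b * w) = letter G b * (letter G a * w) := fun w => by
    rw [← mul_assoc, letter_mul_comm h, mul_assoc]
  obtain ⟨w, d⟩ := p
  simp only [leftDivStep, Prod.mk.injEq]
  refine ⟨hc _, ?_⟩
  by_cases ha : a = v
  · subst ha
    simp [hab.symm, h.symm]
  · by_cases hb : b = v
    · subst hb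
      simp [ha, h]
    · by_cases ha' : G.Adj a v <;> by_cases hb' : G.Adj b v <;>
        simp [ha, hb, ha', hb', Function.comp_def, hc]

/-- The left quotient of a trace monoid element by the letter `v`, if it exists. -/
noncomputable def leftDiv (v : V) (w : TraceMonoid G) : Option (TraceMonoid G) :=
  (PresentedMonoid.lift (rels := TraceRel G)
    (M := Function.End (TraceMonoid G × Option (TraceMonoid G)))
    (fun u => leftDivStep v u) (by
      rintro _ _ ⟨a, b, h⟩
      simp only [map_mul]
      exact funext (leftDivStep_comm v h)) w (1, none)).2

theorem leftDivStep_leftDiv (v u : V) (w : TraceMonoid G) :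
    leftDivStep v u (w, leftDiv v w) = (letter G u * w, leftDiv v (letter G u * w)) := by
  suffices H : ∀ w : TraceMonoid G, (PresentedMonoid.lift (rels := TraceRel G)
    (M := Function.End (TraceMonoid G × Option (TraceMonoid G)))
    (fun u => leftDivStep v u) (by
      rintro _ _ ⟨a, b, h⟩
      simp only [map_mul]
      exact funext (leftDivStep_comm v h)) w (1, none)) = (w, leftDiv v w) by
    rw [← H w, ← H, map_mul]
    rfl
  intro w
  refine Prod.ext ?_ rfl
  induction w using induction_letter with
  | one => rw [map_one]; rfl
  | mul u w ih => 
    rw [map_mul]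
    change letter G u * _ = _
    rw [ih]

@[simp] theorem leftDiv_one (v : V) : leftDiv v (1 : TraceMonoid G) = none := by
  unfold leftDiv
  rw [map_one]
  rfl

open Classical in
theorem leftDiv_letter_mul (v u : V) (w : TraceMonoid G) :
    leftDiv v (letter G u * w) = if u = v then some w else
      if G.Adj u v then (leftDiv v w).map (letter G u * ·) else none :=
  (congrArg Prod.snd (leftDivStep_leftDiv v u w)).symm

@[simp] theorem leftDiv_letter_mul_self (v : V) (w : TraceMonoid G) :
    leftDiv v (letter G v * w) = some w := by
  simp [leftDiv_letter_mul]

theorem leftDiv_eq_some {v : V} {w a : TraceMonoid G} :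
    leftDiv v w = some a ↔ w = letter G v * a := by
  refine ⟨?_, by rintro rfl; simp⟩
  induction w using induction_letter generalizing a with
  | one => simp
  | mul u w ih =>
    rw [leftDiv_letter_mul]
    split_ifs with h1 h2
    · rintro ⟨⟩
      rw [h1]
    · intro h
      obtain ⟨c, hc, rfl⟩ := Option.map_eq_some_iff.1 h
      rw [ih hc, ← mul_assoc, letter_mul_comm h2, mul_assoc]
    · simp

theorem leftDiv_eq_none {v : V} {w : TraceMonoid G} :
    leftDiv v w = none ↔ ∀ a, w ≠ letter G v * a := by
  simp only [Option.eq_none_iff_forall_ne_some, ne_eq, leftDiv_eq_some]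

theorem letter_mul_left_cancel {v : V} {a b : TraceMonoid G}
    (h : letter G v * a = letter G v * b) : a = b := by
  simpa using congrArg (leftDiv v) h

/-- Levi's lemma for letters of a trace monoid. -/
theorem letter_mul_eq_letter_mul {u v : V} {a b : TraceMonoid G}
    (h : letter G v * a = letter G u * b) :
    (u = v ∧ a = b) ∨ (G.Adj u v ∧ ∃ c, a = letter G u * c ∧ b = letter G v * c) := by
  have h' := (leftDiv_letter_mul_self v a).symm.trans (congrArg (leftDiv v) h)
  rw [leftDiv_letter_mul] at h'
  split_ifs at h' with h1 h2
  · left; exact ⟨h1, by simpa using h'⟩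
  · obtain ⟨c, hc, rfl⟩ := Option.map_eq_some_iff.1 h'.symm
    exact Or.inr ⟨h2, c, rfl, leftDiv_eq_some.1 hc⟩

theorem leftDiv_bind_comm {u v : V} (h : G.Adj u v) (w : TraceMonoid G) :
    (leftDiv u w).bind (leftDiv v) = (leftDiv v w).bind (leftDiv u) := by
  ext e
  simp only [Option.bind_eq_some_iff, leftDiv_eq_some]
  constructor
  · rintro ⟨_, rfl, rfl⟩
    exact ⟨_, by rw [← mul_assoc, letter_mul_comm h, mul_assoc], rfl⟩
  · rintro ⟨_, rfl, rfl⟩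
    exact ⟨_, by rw [← mul_assoc, ← letter_mul_comm h, mul_assoc], rfl⟩

theorem exists_eq_letter_mul {w : TraceMonoid G} (hw : w ≠ 1) : ∃ v a, w = letter G v * a := by
  induction w using induction_letter with
  | one => exact absurd rfl hw
  | mul v a _ => exact ⟨v, a, rfl⟩

theorem exists_eq_pow_mul (v : V) (w : TraceMonoid G) :
    ∃ n a, w = letter G v ^ n * a ∧ leftDiv v a = none := by
  induction h : len w generalizing w with
  | zero =>
    refine ⟨0, w, by simp, leftDiv_eq_none.2 ?_⟩
    rintro a rfl
    simp at h
  | succ n ih =>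
    rcases hd : leftDiv v w with _ | a
    · exact ⟨0, w, by simp, hd⟩
    · obtain rfl := leftDiv_eq_some.1 hd
      obtain ⟨m, b, rfl, hb⟩ := ih a (by simpa using h)
      exact ⟨m + 1, b, by rw [pow_succ', mul_assoc], hb⟩

/-! ### Chebyshev elements -/

section Chebyshev

variable {R : Type*} [Ring R] (s : V → R)

open Classical in
/-- The family of elements of `R` indexed by the trace monoid with `U 1 = 1` and
`s v * U w = U (letter v * w) + U (v \ w)`, where `v \ w` is the left quotient of `w` by `v`. For a
power of a letter, it is a Chebyshev polynomial of the second kind. -/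
noncomputable def chebyshev (s : V → R) (w : TraceMonoid G) : R :=
  if hw : w = 1 then 1 else
    s (exists_eq_letter_mul hw).choose * chebyshev s (exists_eq_letter_mul hw).choose_spec.choose -
      match _h : leftDiv (exists_eq_letter_mul hw).choose
          (exists_eq_letter_mul hw).choose_spec.choose with
      | none => 0
      | some a => chebyshev s a
termination_by len w
decreasing_by
  · have h := congrArg len (exists_eq_letter_mul hw).choose_spec.choose_spec
    rw [len_letter_mul] at h
    omega
  · have h1 := congrArg len (exists_eq_letter_mul hw).choose_spec.choose_spec
    have h2 := congrArg len (leftDiv_eq_some.1 _h)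
    rw [len_letter_mul] at h1 h2
    omega

@[simp] theorem chebyshev_one : chebyshev s (1 : TraceMonoid G) = 1 := by
  rw [chebyshev]; simp

theorem exists_chebyshev_eq {w : TraceMonoid G} (hw : w ≠ 1) : ∃ v a, w = letter G v * a ∧
    chebyshev s w = s v * chebyshev s a - (leftDiv v a).elim 0 (chebyshev s) := by
  refine ⟨_, _, (exists_eq_letter_mul hw).choose_spec.choose_spec, ?_⟩
  rw [chebyshev, dif_neg hw]
  congr 1
  split <;> rename_i h <;> rw [h] <;> rfl

variable {s}

/-- The definition peels off a chosen first letter; the point is that any first letter gives the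
same value. By Levi's lemma, two different first letters are adjacent and the word is `u * v * c`.
-/
theorem chebyshev_letter_mul (hs : ∀ u v, G.Adj u v → s u * s v = s v * s u) (v : V)
    (a : TraceMonoid G) : chebyshev s (letter G v * a) =
      s v * chebyshev s a - (leftDiv v a).elim 0 (chebyshev s) := by
  induction h : len a using Nat.strong_induction_on generalizing a v with
  | h n ih =>
  subst h
  obtain ⟨u, b, hub, hU⟩ := exists_chebyshev_eq s (letter_mul_ne_one v a)
  rw [hU]
  obtain ⟨rfl, rfl⟩ | ⟨huv, c, rfl, rfl⟩ := letter_mul_eq_letter_mul hub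
  · rfl
  -- Expanding twice expresses the value through `c` and its quotients; the result is symmetric in
  -- `x` and `y` once `s x`, `s y` and the two divisions commute.
  have key : ∀ x y, G.Adj x y → (∀ x d, len d ≤ len c → chebyshev s (letter G x * d) =
      s x * chebyshev s d - (leftDiv x d).elim 0 (chebyshev s)) →
      s x * chebyshev s (letter G y * c) - (leftDiv x (letter G y * c)).elim 0 (chebyshev s) =
      s x * s y * chebyshev s c - s x * (leftDiv y c).elim 0 (chebyshev s)
        - s y * (leftDiv x c).elim 0 (chebyshev s)
        + ((leftDiv x c).bind (leftDiv y)).elim 0 (chebyshev s) := by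
    intro x y hxy IH
    rw [IH y c le_rfl, leftDiv_letter_mul, if_neg hxy.ne', if_pos hxy.symm]
    rcases hd : leftDiv x c with _ | d
    · simp [mul_sub, mul_assoc]
    · have hl : len d ≤ len c := by
        rw [leftDiv_eq_some.1 hd, len_letter_mul]; omega
      simp only [Option.map_some, Option.elim_some, Option.bind_some, IH y d hl]
      noncomm_ring
  have IH : ∀ x d, len d ≤ len c → chebyshev s (letter G x * d) =
      s x * chebyshev s d - (leftDiv x d).elim 0 (chebyshev s) := fun x d hd =>
    ih (len d) (by rw [len_letter_mul]; omega) x d rfl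
  rw [key u v huv IH, key v u huv.symm IH, hs u v huv, leftDiv_bind_comm huv]
  abel

theorem mul_chebyshev (hs : ∀ u v, G.Adj u v → s u * s v = s v * s u) (v : V)
    (a : TraceMonoid G) : s v * chebyshev s a =
      chebyshev s (letter G v * a) + (leftDiv v a).elim 0 (chebyshev s) := by
  rw [chebyshev_letter_mul hs, sub_add_cancel]

/-- As `v` does not divide `a`, the recursion in `n` starts like, and coincides with, `S (n + 2) = X
* S (n + 1) - S n`. -/
theorem chebyshev_pow_mul {𝕜 : Type*} [CommRing 𝕜] [Algebra 𝕜 R]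
    (hs : ∀ u v, G.Adj u v → s u * s v = s v * s u) {v : V}
    {a : TraceMonoid G} (ha : leftDiv v a = none) (n : ℕ) :
    chebyshev s (letter G v ^ n * a) =
      Polynomial.aeval (s v) (Polynomial.Chebyshev.S 𝕜 n) * chebyshev s a := by
  induction n using Nat.twoStepInduction with
  | zero => simp
  | one => simp [chebyshev_letter_mul hs, ha]
  | more n h1 h2 =>
    rw [pow_succ', mul_assoc, chebyshev_letter_mul hs, h2, pow_succ', mul_assoc,
      leftDiv_letter_mul_self, Option.elim_some, h1]
    push_cast
    rw [Polynomial.Chebyshev.S_add_two]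
    simp [sub_mul, mul_assoc]

end Chebyshev

/-- If `v` occurs in a product of powers of letters, after letters adjacent to `v` only, then `v`
divides the product on the left. -/
theorem leftDiv_prod_ne_none {v : V} (l : List (V × ℕ)) (j : ℕ) (hj : j < l.length)
    (hv : l[j].1 = v) (hn : l[j].2 ≠ 0)
    (hadj : ∀ i (hi : i < j), G.Adj v (l[i]'(hi.trans hj)).1) :
    leftDiv v (l.map fun p => letter G p.1 ^ p.2).prod ≠ none := by
  induction l generalizing j with
  | nil => simp at hj
  | cons p l ih =>
    rw [Ne, leftDiv_eq_none, not_forall]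
    simp only [List.map_cons, List.prod_cons, not_not]
    cases j with
    | zero =>
      obtain rfl : p.1 = v := by simpa using hv
      obtain ⟨n, hn⟩ := Nat.exists_eq_succ_of_ne_zero (by simpa using hn : p.2 ≠ 0)
      exact ⟨_, by rw [hn, pow_succ', mul_assoc]⟩
    | succ j =>
      have := ih j (by simpa using hj) (by simpa using hv) (by simpa using hn)
        (fun i hi => by simpa using hadj (i + 1) (by omega))
      obtain ⟨c, hc⟩ := Option.ne_none_iff_exists'.1 this
      rw [leftDiv_eq_some] at hc
      have hcomm : Commute (letter G v) (letter G p.1) :=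
        letter_mul_comm (by simpa using hadj 0 (by omega))
      exact ⟨_, by rw [hc, ← mul_assoc, ← (hcomm.pow_right _).eq, mul_assoc]⟩

/-- Every element of the trace monoid has a `G`-reduced factorization into powers of letters,
along which the Chebyshev elements factorize. -/
theorem exists_reduced_factorization {R : Type*} [Ring R] {s : V → R} (𝕜 : Type*) [CommRing 𝕜]
    [Algebra 𝕜 R] (hs : ∀ u v, G.Adj u v → s u * s v = s v * s u) (w : TraceMonoid G) :
    ∃ l : List (V × ℕ), (∀ p ∈ l, p.2 ≠ 0) ∧
      w = (l.map fun p => letter G p.1 ^ p.2).prod ∧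
      chebyshev s w =
        (l.map fun p => Polynomial.aeval (s p.1) (Polynomial.Chebyshev.S 𝕜 p.2)).prod ∧
      ∀ j₁ j₂ (h₂ : j₂ < l.length) (h₁ : j₁ < j₂), (l[j₁]'(h₁.trans h₂)).1 = l[j₂].1 →
        ∃ j₃, ∃ (h₃ : j₃ < j₂), j₁ < j₃ ∧
          ¬ G.Adj (l[j₁]'(h₁.trans h₂)).1 (l[j₃]'(h₃.trans h₂)).1 := by
  induction h : len w using Nat.strong_induction_on generalizing w with
  | h n ih =>
  subst h
  by_cases hw : w = 1
  · exact ⟨[], by simp [hw]⟩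
  obtain ⟨v, b, rfl⟩ := exists_eq_letter_mul hw
  -- Extracting the maximal power of `v` leaves a remainder not divisible by `v`.
  obtain ⟨n, a, rfl, ha⟩ := exists_eq_pow_mul v b
  have hlen : ∀ n : ℕ, len a ≤ len (letter G v ^ n * a) := by
    intro n
    induction n with
    | zero => simp
    | succ n ih => rw [pow_succ', mul_assoc, len_letter_mul]; omega
  obtain ⟨l, hl0, rfl, hU, hl⟩ := ih (len a) (by
    rw [len_letter_mul]; have := hlen n; omega) a rfl
  refine ⟨(v, n + 1) :: l, by simpa using hl0, by simp [pow_succ', mul_assoc], ?_, ?_⟩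
  · rw [← mul_assoc, ← pow_succ', chebyshev_pow_mul (𝕜 := 𝕜) hs ha, hU]
    simp
  · intro j₁ j₂ h₂ h₁ heq
    obtain ⟨j₂, rfl⟩ : ∃ k, j₂ = k + 1 := ⟨j₂ - 1, by omega⟩
    have h₂' : j₂ < l.length := by simpa using h₂
    cases j₁ with
    | zero =>
      -- If every letter in between were adjacent to `v`, the later power of `v` could move to the
      -- front of the remainder, against maximality.
      by_contra! hcon
      refine leftDiv_prod_ne_none l j₂ h₂' (by simpa using heq.symm)
        (hl0 _ (List.getElem_mem _)) (fun i hi => ?_) ha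
      simpa using hcon (i + 1) (by omega) (by omega)
    | succ j₁ =>
      obtain ⟨j₃, h₃, h₁₃, hadj⟩ := hl j₁ j₂ h₂' (by omega) (by simpa using heq)
      exact ⟨j₃ + 1, by omega, by omega, by simpa using hadj⟩

end TraceMonoid

/-! ### Semicircular elements -/

open Polynomial in
/-- The polynomials `S n` with `n ≠ 0` are orthogonal to `1` for the semicircle law. -/
theorem integral_chebyshevS_mul_sqrt {n : ℕ} (hn : n ≠ 0) :
    ∫ t in (-2 : ℝ)..2, (Chebyshev.S ℝ n).eval t * Real.sqrt (4 - t ^ 2) = 0 := by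
  -- Substituting `t = 2 cos θ` reverses the orientation of the interval.
  have hsub := intervalIntegral.integral_comp_mul_deriv (a := 0) (b := Real.pi)
    (f := fun θ => 2 * Real.cos θ) (f' := fun θ => 2 * (-Real.sin θ))
    (g := fun t => (Chebyshev.S ℝ n).eval t * Real.sqrt (4 - t ^ 2))
    (fun θ _ => (Real.hasDerivAt_cos θ).const_mul 2) (by fun_prop)
    (by have := (Chebyshev.S ℝ n).continuous; fun_prop)
  rw [intervalIntegral.integral_symm]
  norm_num at hsub
  rw [← hsub, neg_eq_zero]
  -- Since `S n (2 cos θ) sin θ = sin ((n + 1) θ)`, the integrand becomes a difference of cosines of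
  -- nonzero frequencies.
  have hpt : ∀ θ ∈ Set.uIcc 0 Real.pi,
      -(eval (2 * Real.cos θ) (Chebyshev.S ℝ n) * √(4 - (2 * Real.cos θ) ^ 2) *
        (2 * Real.sin θ)) = 2 * (Real.cos ((n + 2 : ℕ) * θ) - Real.cos (n * θ)) := by
    intro θ hθ
    rw [Set.uIcc_of_le Real.pi_pos.le] at hθ
    have h0 := Real.sin_nonneg_of_mem_Icc hθ
    have hsq : √(4 - (2 * Real.cos θ) ^ 2) = 2 * Real.sin θ := by
      rw [show 4 - (2 * Real.cos θ) ^ 2 = (2 * Real.sin θ) ^ 2 by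
        have := Real.sin_sq_add_cos_sq θ; linear_combination -4 * this]
      exact Real.sqrt_sq (by positivity)
    have hS := Chebyshev.S_two_mul_real_cos θ (n : ℤ)
    rw [hsq, show eval (2 * Real.cos θ) (Chebyshev.S ℝ n) * (2 * Real.sin θ) * (2 * Real.sin θ)
      = 4 * (eval (2 * Real.cos θ) (Chebyshev.S ℝ n) * Real.sin θ) * Real.sin θ by ring, hS]
    have h1 : ((n + 2 : ℕ) : ℝ) * θ = (n + 1) * θ + θ := by push_cast; ring
    have h2 : (n : ℝ) * θ = (n + 1) * θ - θ := by ring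
    rw [h1, h2, Real.cos_add, Real.cos_sub]
    push_cast
    ring
  have hcos : ∀ m : ℕ, m ≠ 0 → ∫ θ in (0 : ℝ)..Real.pi, Real.cos (m * θ) = 0 := by
    intro m hm
    rw [intervalIntegral.integral_comp_mul_left _ (Nat.cast_ne_zero.2 hm)]
    simp [Real.sin_nat_mul_pi]
  rw [← intervalIntegral.integral_neg, intervalIntegral.integral_congr hpt,
    intervalIntegral.integral_const_mul, intervalIntegral.integral_sub
      (by apply Continuous.intervalIntegrable; fun_prop)
      (by apply Continuous.intervalIntegrable; fun_prop), hcos _ (by omega), hcos _ hn]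
  simp

section

variable {𝓐 : Type*} [CStarAlgebra 𝓐] {τ : 𝓐 →ₗ[ℂ] ℂ}

open Polynomial in
theorem IsSemicircular.map_aeval {s : 𝓐} (hs : IsSemicircular τ s) (p : ℝ[X]) :
    τ (aeval s (p.map (algebraMap ℝ ℂ))) = (((1 / (2 * Real.pi)) *
      ∫ t in (-2 : ℝ)..2, p.eval t * Real.sqrt (4 - t ^ 2) : ℝ) : ℂ) := by
  have hint : ∀ p : ℝ[X], IntervalIntegrable (fun t => p.eval t * Real.sqrt (4 - t ^ 2))
      MeasureTheory.volume (-2) 2 := fun p => by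
    have := p.continuous
    exact Continuous.intervalIntegrable (by fun_prop) _ _
  induction p using Polynomial.induction_on' with
  | add p q hp hq =>
    simp only [Polynomial.map_add, map_add, hp, hq, eval_add, add_mul]
    rw [intervalIntegral.integral_add (hint p) (hint q), mul_add, Complex.ofReal_add]
  | monomial n a =>
    simp only [map_monomial, aeval_monomial, eval_monomial, mul_assoc]
    rw [intervalIntegral.integral_const_mul, ← Algebra.smul_def, map_smul, hs.moment]
    simp only [Complex.coe_algebraMap, smul_eq_mul, ← Complex.ofReal_mul]
    congr 1
    ring

open Polynomial in
theorem IsSemicircular.map_chebyshevS {s : 𝓐} (hs : IsSemicircular τ s) {n : ℕ} (hn : n ≠ 0) :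
    τ (aeval s (Chebyshev.S ℂ n)) = 0 := by
  rw [← Chebyshev.map_S (algebraMap ℝ ℂ), hs.map_aeval, integral_chebyshevS_mul_sqrt hn]
  simp

/-! ### Orthonormality of the Chebyshev elements. -/

namespace IsGIndependentSemicircularFamily

variable {V : Type*} {G : SimpleGraph V} {s : V → 𝓐}

open TraceMonoid

theorem mul_comm_of_adj (hs : IsGIndependentSemicircularFamily τ G s) (u v : V)
    (h : G.Adj u v) : s u * s v = s v * s u :=
  (hs.gIndependent.independent_of_adj u v h).commute 0 1 (by simp) _
    (Algebra.self_mem_adjoin_singleton ℂ (s u)) _ (Algebra.self_mem_adjoin_singleton ℂ (s v))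

theorem map_chebyshev (hs : IsGIndependentSemicircularFamily τ G s) {w : TraceMonoid G}
    (hw : w ≠ 1) : τ (chebyshev s w) = 0 := by
  obtain ⟨l, hl0, rfl, hU, hl⟩ := exists_reduced_factorization ℂ hs.mul_comm_of_adj w
  have hpos : 1 ≤ l.length := by
    rcases l with _ | _
    · simp at hw
    · simp
  have hofFn : l.map (fun p => Polynomial.aeval (s p.1) (Polynomial.Chebyshev.S ℂ p.2)) =
      List.ofFn fun j : Fin l.length =>
        Polynomial.aeval (s l[j].1) (Polynomial.Chebyshev.S ℂ l[j].2) := by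
    apply List.ext_getElem <;> simp
  rw [hU, hofFn]
  refine hs.gIndependent.centered l.length hpos (fun j => l[j].1) ?_ _
    (fun j => Polynomial.aeval_mem_adjoin_singleton ℂ _)
    (fun j => (hs.semicircular _).map_chebyshevS (hl0 _ (List.getElem_mem _)))
  intro j₁ j₂ h₁ heq
  obtain ⟨j₃, h₃, h₁₃, hadj⟩ := hl j₁ j₂ j₂.2 h₁ heq
  exact ⟨⟨j₃, h₃.trans j₂.2⟩, h₁₃, h₃, hadj⟩

open Classical in
/-- The Chebyshev elements are orthonormal for the inner product of the state. -/
theorem map_star_chebyshev_mul_chebyshev (hτ : τ 1 = 1)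
    (hs : IsGIndependentSemicircularFamily τ G s) (w w' : TraceMonoid G) :
    τ (star (chebyshev s w) * chebyshev s w') = if w = w' then 1 else 0 := by
  induction h : len w using Nat.strong_induction_on generalizing w w' with
  | h n ih =>
  subst h
  by_cases hw : w = 1
  · subst hw
    split_ifs with h
    · simp [← h, hτ]
    · simpa using hs.map_chebyshev (Ne.symm h)
  obtain ⟨v, a, rfl⟩ := exists_eq_letter_mul hw
  have hU := mul_chebyshev hs.mul_comm_of_adj
  -- Self-adjointness moves `s v` to the right factor. By induction the first and third terms have
  -- the same trace and cancel; the middle one gives the claim.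
  have key : star (chebyshev s (letter G v * a)) * chebyshev s w' =
      star (chebyshev s a) * chebyshev s (letter G v * w') +
      star (chebyshev s a) * (leftDiv v w').elim 0 (chebyshev s) -
      star ((leftDiv v a).elim 0 (chebyshev s)) * chebyshev s w' := by
    rw [← mul_add, ← hU, chebyshev_letter_mul hs.mul_comm_of_adj, star_sub, star_mul,
      (hs.semicircular v).isSelfAdjoint.star_eq, sub_mul, mul_assoc]
  have h1 : τ (star (chebyshev s a) * (leftDiv v w').elim 0 (chebyshev s)) =
      if letter G v * a = w' then 1 else 0 := by
    rcases hd : leftDiv v w' with _ | b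
    · rw [leftDiv_eq_none] at hd
      simp [(hd a).symm]
    · obtain rfl := leftDiv_eq_some.1 hd
      rw [Option.elim_some, ih (len a) (by simp) _ _ rfl]
      exact if_congr ⟨congrArg _, letter_mul_left_cancel⟩ rfl rfl
  have h2 : τ (star ((leftDiv v a).elim 0 (chebyshev s)) * chebyshev s w') =
      if a = letter G v * w' then 1 else 0 := by
    rcases hd : leftDiv v a with _ | b
    · rw [leftDiv_eq_none] at hd
      simp [hd w']
    · obtain rfl := leftDiv_eq_some.1 hd
      rw [Option.elim_some, ih (len b) (by simp) _ _ rfl]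
      exact if_congr ⟨congrArg _, letter_mul_left_cancel⟩ rfl rfl
  rw [key, map_sub, map_add, h1, h2, ih (len a) (by simp) _ _ rfl]
  ring

end IsGIndependentSemicircularFamily

end

open TraceMonoid

/-! ### Norm bounds from moments. -/

section

variable {𝓐 : Type*} [CStarAlgebra 𝓐] {τ : 𝓐 →ₗ[ℂ] ℂ}

/-- The norm of a self-adjoint element is bounded by the growth rate of its moments with respect to
a faithful state. -/
theorem IsFaithfulTracialState.norm_le_of_map_pow_le (hτ : IsFaithfulTracialState τ) {x : 𝓐}
    (hx : IsSelfAdjoint x) {r : ℝ} (hr : 0 ≤ r) (h : ∀ n, ‖τ (x ^ n)‖ ≤ r ^ n) : ‖x‖ ≤ r := by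
  let _ := CStarAlgebra.spectralOrder 𝓐
  have := CStarAlgebra.spectralOrderedRing 𝓐
  refine le_of_forall_gt_imp_ge_of_dense fun q hq => ?_
  have hq0 : 0 < q := hr.trans_lt hq
  have hτmono : ∀ a b : 𝓐, a ≤ b → τ a ≤ τ b := by
    intro a b hab
    obtain ⟨c, hc⟩ := CStarAlgebra.nonneg_iff_eq_star_mul_self.1 (sub_nonneg.2 hab)
    rw [← sub_nonneg, ← map_sub, hc]
    exact hτ.nonneg c
  -- `g` vanishes exactly on `|t| ≤ q`, so `g(x) = 0` confines the spectrum to `[-q, q]`. Where `|t|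
  -- ≥ q`, `(t / q) ^ (2 * n) ≥ 1`, so the moments force `τ (star y * y)` to decay like `(r / q) ^
  -- (2 * n)`.
  let g : ℝ → ℝ := fun t => max (t ^ 2 - q ^ 2) 0
  have hg : Continuous g := by fun_prop
  have hspec : ∀ t ∈ spectrum ℝ x, |t| ≤ ‖x‖ := by
    have := (norm_cfc_le_iff (id : ℝ → ℝ) x (norm_nonneg x)).1 (by rw [cfc_id ℝ x])
    simpa using this
  set y := cfc g x with hy
  have hysa : star y = y := (cfc_predicate g x : IsSelfAdjoint _).star_eq
  have hyy : star y * y = cfc (fun t => g t * g t) x := by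
    rw [hysa, cfc_mul g g x hg.continuousOn hg.continuousOn]
  have hbound : ∀ n : ℕ, star y * y ≤ (‖x‖ ^ 4 * (q⁻¹) ^ (2 * n)) • x ^ (2 * n) := by
    intro n
    rw [hyy, ← cfc_pow_id (R := ℝ) x (2 * n), ← cfc_const_mul _ _ x]
    refine cfc_mono (fun t ht => ?_)
    have ht2 : t ^ 2 ≤ ‖x‖ ^ 2 := sq_le_sq.2 (by simpa using hspec t ht)
    rcases le_total (t ^ 2) (q ^ 2) with hle | hle
    · have : g t = 0 := max_eq_right (by linarith)
      rw [this, mul_zero, pow_mul t]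
      positivity
    · have h1 : g t = t ^ 2 - q ^ 2 := max_eq_left (by linarith)
      have h2 : g t ≤ ‖x‖ ^ 2 := by rw [h1]; nlinarith
      have h0 : 0 ≤ g t := le_max_right _ _
      have h3 : 1 ≤ q⁻¹ ^ (2 * n) * t ^ (2 * n) := by
        rw [← mul_pow, pow_mul]
        refine one_le_pow₀ ?_
        rw [mul_pow, inv_pow, inv_mul_eq_div]
        exact (one_le_div (by positivity)).2 hle
      calc g t * g t ≤ ‖x‖ ^ 2 * ‖x‖ ^ 2 := by gcongr
        _ = ‖x‖ ^ 4 * 1 := by ring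
        _ ≤ ‖x‖ ^ 4 * (q⁻¹ ^ (2 * n) * t ^ (2 * n)) := by gcongr
        _ = _ := by ring
  have hle : ∀ n : ℕ, (τ (star y * y)).re ≤ ‖x‖ ^ 4 * ((r / q) ^ 2) ^ n := by
    intro n
    have h1 := (Complex.le_def.1 (hτmono _ _ (hbound n))).1
    rw [← Complex.coe_smul, map_smul, smul_eq_mul, Complex.re_ofReal_mul] at h1
    refine h1.trans ?_
    have h2 : (τ (x ^ (2 * n))).re ≤ r ^ (2 * n) := (Complex.re_le_norm _).trans (h _)
    calc _ ≤ ‖x‖ ^ 4 * q⁻¹ ^ (2 * n) * r ^ (2 * n) := by gcongr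
      _ = _ := by rw [← pow_mul, div_pow, inv_pow]; ring
  have hlim : Filter.Tendsto (fun n : ℕ => ‖x‖ ^ 4 * ((r / q) ^ 2) ^ n) Filter.atTop (nhds 0) := by
    have hrq : r / q < 1 := (div_lt_one hq0).2 hq
    have hrq0 : 0 ≤ r / q := by positivity
    simpa using (tendsto_pow_atTop_nhds_zero_of_lt_one (r := (r / q) ^ 2) (by positivity)
      (by nlinarith)).const_mul (‖x‖ ^ 4)
  have hre : (τ (star y * y)).re ≤ 0 := ge_of_tendsto' hlim hle
  have hnn := Complex.le_def.1 (hτ.nonneg y)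
  have hy0 : y = 0 := hτ.faithful y (Complex.ext (le_antisymm hre hnn.1) hnn.2.symm)
  have hg0 : ∀ t ∈ spectrum ℝ x, g t = 0 := by
    have := (norm_cfc_le_iff g x le_rfl hg.continuousOn).1 (by rw [← hy, hy0, norm_zero])
    exact fun t ht => norm_le_zero_iff.1 (this t ht)
  have hfin := (norm_cfc_le_iff (id : ℝ → ℝ) x hq0.le).2 (fun t ht => ?_)
  · rwa [cfc_id ℝ x] at hfin
  · have h1 : t ^ 2 - q ^ 2 ≤ 0 := (le_max_left _ _).trans (hg0 t ht).le
    exact abs_le_of_sq_le_sq (sub_nonpos.1 h1) hq0.le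

end

/-! ### The adjacency operator in the GNS space. -/

-- At most one summand is nonzero: length excludes both directions at once, and right cancellation
-- determines the letter.
open Classical in
theorem TraceMonoid.sum_ite_eq_adjMatrix {V : Type*} [Fintype V] {G : SimpleGraph V}
    (w w' : TraceMonoid G) :
    ∑ v, ((if w = letter G v * w' then 1 else 0) + (if w' = letter G v * w then 1 else 0) : ℂ) =
      (cayleyGraph G).adjMatrix ℂ w w' := by
  have key : ∀ (w w' : TraceMonoid G) (v : V), w = letter G v * w' →
      ∑ v, ((if w = letter G v * w' then 1 else 0) +
        (if w' = letter G v * w then 1 else 0) : ℂ) = 1 := by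
    intro w w' v hv
    rw [Finset.sum_eq_single v]
    · rw [if_pos hv, if_neg, add_zero]
      intro h
      have h1 := congrArg len hv
      have h2 := congrArg len h
      rw [len_letter_mul] at h1 h2
      omega
    · intro u _ huv
      rw [if_neg, if_neg, add_zero]
      · intro h
        have h1 := congrArg len hv
        have h2 := congrArg len h
        rw [len_letter_mul] at h1 h2
        omega
      · exact fun h => huv (letter_mul_right_cancel (h.symm.trans hv))
    · simp
  rw [SimpleGraph.adjMatrix_apply]
  split_ifs with h
  · obtain ⟨v, hv | hv⟩ := h
    · exact key w w' v hv
    · exact (Finset.sum_congr rfl fun _ _ => add_comm _ _).trans (key w' w v hv)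
  · refine Finset.sum_eq_zero fun v _ => ?_
    rw [if_neg fun hv => h ⟨v, .inl hv⟩, if_neg fun hv => h ⟨v, .inr hv⟩, add_zero]

open Classical in
/-- The image of the basis vector at `w` under the adjacency operator of the Cayley graph. -/
noncomputable def TraceMonoid.neighborSum {V : Type*} [Fintype V] {G : SimpleGraph V}
    (w : TraceMonoid G) : lp (fun _ : TraceMonoid G => ℂ) 2 :=
  ∑ v, (lp.single 2 (letter G v * w) (1 : ℂ) + (leftDiv v w).elim 0 fun a => lp.single 2 a (1 : ℂ))

open Classical in
theorem TraceMonoid.neighborSum_apply {V : Type*} [Fintype V] {G : SimpleGraph V}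
    (w w' : TraceMonoid G) : neighborSum w' w = (cayleyGraph G).adjMatrix ℂ w w' := by
  rw [← sum_ite_eq_adjMatrix, neighborSum, lp.coeFn_sum, Finset.sum_apply]
  refine Finset.sum_congr rfl fun v _ => ?_
  rw [lp.coeFn_add, Pi.add_apply, lp.single_apply, Pi.single_apply]
  congr 1
  rcases hd : leftDiv v w' with _ | a
  · rw [leftDiv_eq_none] at hd
    simp [hd]
  · obtain rfl := leftDiv_eq_some.1 hd
    rw [Option.elim_some, lp.single_apply, Pi.single_apply]
    exact if_congr ⟨fun h => by rw [h], fun h => (letter_mul_left_cancel h).symm⟩ rfl rfl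

theorem IsGIndependentSemicircularFamily.exists_isAdjacencyOperator {V : Type*} [Fintype V]
    {G : SimpleGraph V} {𝓐 : Type*} [CStarAlgebra 𝓐] {τ : 𝓐 →ₗ[ℂ] ℂ}
    (hτ : IsFaithfulTracialState τ) {s : V → 𝓐} (hs : IsGIndependentSemicircularFamily τ G s) :
    ∃ A : lp (fun _ : TraceMonoid G => ℂ) 2 →L[ℂ] lp (fun _ : TraceMonoid G => ℂ) 2,
      IsAdjacencyOperator (TraceMonoid.cayleyGraph G) A ∧ IsSelfAdjoint A ∧
      ‖∑ i, s i‖ = ‖A‖ := by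
  classical
  let _ := CStarAlgebra.spectralOrder 𝓐
  have := CStarAlgebra.spectralOrderedRing 𝓐
  let f : 𝓐 →ₚ[ℂ] ℂ := PositiveLinearMap.mk₀ τ fun a ha => by
    obtain ⟨c, rfl⟩ := CStarAlgebra.nonneg_iff_eq_star_mul_self.1 ha
    exact hτ.nonneg c
  let toH : 𝓐 →ₗ[ℂ] f.GNS :=
    (UniformSpace.Completion.toComplL (𝕜 := ℂ) (E := f.PreGNS)).toLinearMap ∘ₗ
      f.toPreGNS.toLinearMap
  have hinner : ∀ a b : 𝓐, inner ℂ (toH a) (toH b) = τ (star a * b) := fun a b =>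
    UniformSpace.Completion.inner_coe _ _
  let π := f.gnsStarAlgHom
  have hπ : ∀ a b : 𝓐, π a (toH b) = toH (a * b) := fun a b =>
    f.gnsNonUnitalStarAlgHom_apply_coe
  let e : TraceMonoid G → f.GNS := fun w => toH (chebyshev s w)
  have he : Orthonormal ℂ e := by
    rw [orthonormal_iff_ite]
    exact fun w w' => (hinner _ _).trans (hs.map_star_chebyshev_mul_chebyshev hτ.map_one w w')
  let J := he.orthogonalFamily.linearIsometry
  have hJ : ∀ w, J (lp.single 2 w (1 : ℂ)) = e w := fun w => by
    rw [OrthogonalFamily.linearIsometry_apply_single]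
    simp
  set x := ∑ i, s i with hx
  have hxsa : IsSelfAdjoint x := by
    rw [hx, IsSelfAdjoint, star_sum]
    exact Finset.sum_congr rfl fun i _ => (hs.semicircular i).isSelfAdjoint.star_eq
  have hJx : ∀ w, π x (J (lp.single 2 w (1 : ℂ))) = J (neighborSum w) := by
    intro w
    rw [hJ, hπ, hx, Finset.sum_mul, neighborSum, map_sum, map_sum]
    refine Finset.sum_congr rfl fun v _ => ?_
    rw [mul_chebyshev hs.mul_comm_of_adj, map_add, map_add, hJ]
    congr 1
    rcases leftDiv v w with _ | a
    · simp
    · exact (hJ a).symm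
  let J' := J.toContinuousLinearMap
  have hJJ : ContinuousLinearMap.adjoint J' ∘L J' = 1 := J.adjoint_comp_self
  let A := ContinuousLinearMap.adjoint J' ∘L π x ∘L J'
  have hA : ∀ w, A (lp.single 2 w (1 : ℂ)) = neighborSum w := fun w => by
    change ContinuousLinearMap.adjoint J' (π x (J _)) = _
    rw [hJx]
    exact DFunLike.congr_fun hJJ _
  have hAsa : IsSelfAdjoint A := (hxsa.map π).adjoint_conj J'
  -- Checked on basis vectors: the range of `J` is invariant, so the compression `A` is a genuine
  -- restriction and powers of `A` follow powers of `x`.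
  have hJA : J' ∘L A = π x ∘L J' := by
    refine lp.ext_continuousLinearMap (ENNReal.ofNat_ne_top (n := nat_lit 2)) fun w => ?_
    ext
    change J (A (lp.single 2 w (1 : ℂ))) = π x (J (lp.single 2 w (1 : ℂ)))
    rw [hA, hJx]
  refine ⟨A, fun w w' => ?_, hAsa, le_antisymm ?_ ?_⟩
  · rw [← neighborSum_apply, ← hA]
  -- `J` need not be onto, so the bound on `x` comes from the moments at the vacuum vector `δ`, the
  -- basis vector at `1`.
  · refine hτ.norm_le_of_map_pow_le hxsa (norm_nonneg A) fun n => ?_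
    let δ : lp (fun _ : TraceMonoid G => ℂ) 2 := lp.single 2 1 1
    have hδ : J δ = toH 1 := by rw [hJ]; simp [e]
    have hδn : ‖δ‖ = 1 := by
      rw [← J.norm_map, hδ, ← chebyshev_one (G := G) s]
      exact he.1 1
    have hpow : ∀ n, J ((A ^ n) δ) = toH (x ^ n) := by
      intro n
      induction n with
      | zero => simpa using hδ
      | succ n ih =>
        rw [pow_succ', pow_succ', ← hπ, ← ih]
        exact DFunLike.congr_fun hJA _
    have : τ (x ^ n) = inner ℂ δ ((A ^ n) δ) := by
      rw [← J.inner_map_map, hpow, hδ, hinner, star_one, one_mul]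
    rw [this]
    calc _ ≤ ‖δ‖ * ‖(A ^ n) δ‖ := norm_inner_le_norm _ _
      _ ≤ ‖δ‖ * (‖A ^ n‖ * ‖δ‖) := by gcongr; exact (A ^ n).le_opNorm δ
      _ = ‖A ^ n‖ := by rw [hδn]; ring
      _ ≤ ‖A‖ ^ n := by
        rcases n with _ | n
        · rw [pow_zero, pow_zero]; exact ContinuousLinearMap.norm_id_le
        · exact norm_pow_le' A n.succ_pos
  · refine ContinuousLinearMap.opNorm_le_bound _ (norm_nonneg _) fun y => ?_
    calc ‖A y‖ = ‖J (A y)‖ := (J.norm_map _).symm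
      _ = ‖π x (J y)‖ := congrArg norm (DFunLike.congr_fun hJA y)
      _ ≤ ‖π x‖ * ‖J y‖ := (π x).le_opNorm _
      _ ≤ ‖x‖ * ‖y‖ := by rw [J.norm_map]; gcongr; exact NonUnitalStarAlgHom.norm_apply_le π x

theorem theorem1p3 {L : ℕ} (G : SimpleGraph (Fin L))
    {𝓐 : Type*} [CStarAlgebra 𝓐] (τ : 𝓐 →ₗ[ℂ] ℂ) (hτ : IsFaithfulTracialState τ)
    (s : Fin L → 𝓐) (hs : IsGIndependentSemicircularFamily τ G s) :
    ∃ A : lp (fun _ : TraceMonoid G => ℂ) 2 →L[ℂ] lp (fun _ : TraceMonoid G => ℂ) 2,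
      IsAdjacencyOperator (TraceMonoid.cayleyGraph G) A ∧
      ‖∑ i, s i‖ = ‖A‖ ∧
      spectralRadius ℂ A = ENNReal.ofReal ‖∑ i, s i‖ := by
  obtain ⟨A, hA, hsa, hnorm⟩ := hs.exists_isAdjacencyOperator hτ
  refine ⟨A, hA, hnorm, ?_⟩
  rw [hsa.spectralRadius_eq_nnnorm, hnorm, ofReal_norm, enorm_eq_nnnorm]
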